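/- All manifolds and tensor fields are smooth. Put $\tau_1=\tau_2=-1$ and $\tau_3=+1$. A \emph{mixed 3-structure} on a manifold $M$ is a triple $(\varphi_a,\xi_a,\eta^a)$, $a=1,2,3$, of $(1,1)$-tensor fields, vector fields and 1-forms with $\eta^a(\xi_a)=1$ and $\varphi_a^2=-\tau_a(I-\eta^a\otimes\xi_a)$, such that for every cyclic permutation $(a,b,c)$ of $(1,2,3)$ $$\varphi_a\varphi_b-\tau_a\eta^b\otimes\xi_a=\tau_c\varphi_c=-\varphi_b\varphi_a+\tau_b\eta^a\otimes\xi_b,\qquad \eta^a\circ\varphi_b=\tau_c\eta^c=-\eta^b\circ\varphi_a,\qquad \varphi_a\xi_b=\tau_b\xi_c,\qquad \varphi_b\xi_a=-\tau_a\xi_c .$$ Let $g$ be a metric tensor on $M$ (symmetric, nondegenerate, of any signature). The structure $(\varphi_a,\xi_a,\eta^a,g)$ is \emph{mixed 3-Sasakian} if, for each $a$, $\varepsilon_a:=g(\xi_a,\xi_a)=\pm1$ and $g(\varphi_aX,\varphi_aY)=\tau_a\bigl(g(X,Y)-\varepsilon_a\eta^a(X)\eta^a(Y)\bigr)$, and $(\varphi_1,\xi_1,\eta^1,g)$,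 $(\varphi_2,\xi_2,\eta^2,g)$ are paraSasakian and $(\varphi_3,\xi_3,\eta^3,g)$ is indefinite Sasakian, i.e. $d\eta^a(X,Y)=g(X,\varphi_aY)$ and $N_{\varphi_a}=-2\tau_a\,d\eta^a\otimes\xi_a$, where $2\,d\eta(X,Y)=X(\eta(Y))-Y(\eta(X))-\eta([X,Y])$ and $N_\varphi(X,Y)=\varphi^2[X,Y]+[\varphi X,\varphi Y]-\varphi[\varphi X,Y]-\varphi[X,\varphi Y]$. The structure is \emph{positive} if $\varepsilon_1=\varepsilon_2=+1$, and \emph{negative} if $\varepsilon_1=\varepsilon_2=-1$. For a function $k:M\to\mathbb R$, $(M,g)$ has \emph{pointwise constant sectional curvature} $k$ if at each $p\in M$ every nondegenerate tangent plane, spanned by $X,Y$, has sectional curvature $$\frac{g(R(X,Y)Y,X)}{g(X,X)g(Y,Y)-g(X,Y)^2}=k(p),$$ where $R(X,Y)Z=\nabla_X\nabla_YZ-\nabla_Y\nabla_XZ-\nabla_{[X,Y]}Z$ for the Levi-Civita connection $\nabla$ of $g$. \textbf{Proposition.} Let $(M^{4n+3},\varphi_a,\xi_a,\eta^a,g)$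 be a mixed 3-Sasakian manifold that is positive or negative, and put $\sigma=+1$ or $\sigma=-1$ accordingly. If $M$ has pointwise constant sectional curvature $k$ for some function $k:M\to\mathbb R$, then $k=-\sigma$ identically. Hence $M$ has pointwise constant sectional curvature if and only if it has constant sectional curvature $-\sigma$, that is, $-1$ if the 3-structure is positive and $+1$ if it is negative. -/

import Mathlib

open Bundle VectorField
open scoped Manifold ContDiff

noncomputable section

/-- A metric tensor on a smooth manifold `M` modelled on `E`: a smooth, symmetric, nondegenerate
tensor field of type `(0,2)`, of arbitrary signature. -/
structure MetricTensor (E : Type*) [NormedAddCommGroup E] [NormedSpace ℝ E]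
    (M : Type*) [TopologicalSpace M] [ChartedSpace E M] [IsManifold 𝓘(ℝ, E) ∞ M] where
  val (p : M) : TangentSpace 𝓘(ℝ, E) p →L[ℝ] TangentSpace 𝓘(ℝ, E) p →L[ℝ] ℝ
  symm (p : M) (u v : TangentSpace 𝓘(ℝ, E) p) : val p u v = val p v u
  nondegenerate (p : M) (u : TangentSpace 𝓘(ℝ, E) p) (hu : ∀ v, val p u v = 0) : u = 0
  contMDiff : ContMDiff 𝓘(ℝ, E) (𝓘(ℝ, E).prod 𝓘(ℝ, E →L[ℝ] E →L[ℝ] ℝ)) ∞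
    (fun p : M ↦ TotalSpace.mk' (E →L[ℝ] E →L[ℝ] ℝ)
      (E := fun p : M ↦ TangentSpace 𝓘(ℝ, E) p →L[ℝ] TangentSpace 𝓘(ℝ, E) p →L[ℝ] ℝ) p (val p))

namespace MetricTensor

variable {E : Type*} [NormedAddCommGroup E] [NormedSpace ℝ E]
  {M : Type*} [TopologicalSpace M] [ChartedSpace E M] [IsManifold 𝓘(ℝ, E) ∞ M]
  (g : MetricTensor E M)

lemma mdifferentiableAt_apply {X Y : (p : M) → TangentSpace 𝓘(ℝ, E) p} {p : M}
    (hX : MDiffAt (T% X) p) (hY : MDiffAt (T% Y) p) :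
    MDiffAt (fun q ↦ g.val q (X q) (Y q)) p := by
  have hg := (g.contMDiff p).mdifferentiableAt (by simp)
  have h : MDifferentiableAt 𝓘(ℝ, E) (𝓘(ℝ, E).prod 𝓘(ℝ, ℝ))
      (fun q ↦ TotalSpace.mk' ℝ (E := Bundle.Trivial M ℝ) q (g.val q (X q) (Y q))) p :=
    MDifferentiableAt.clm_bundle_apply₂ (F₁ := E) (F₂ := E) hg hX hY
  simp only [mdifferentiableAt_totalSpace] at h
  exact h.2

/-- The right-hand side of the Koszul formula for `2 g(∇_X Y, Z)`, as a function on `M`. -/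
def koszul (X Y Z : (p : M) → TangentSpace 𝓘(ℝ, E) p) (p : M) : ℝ :=
  (d% (fun q ↦ g.val q (Y q) (Z q)) p) (X p)
    + (d% (fun q ↦ g.val q (Z q) (X q)) p) (Y p)
    - (d% (fun q ↦ g.val q (X q) (Y q)) p) (Z p)
    + g.val p (mlieBracket 𝓘(ℝ, E) X Y p) (Z p)
    - g.val p (mlieBracket 𝓘(ℝ, E) Y Z p) (X p)
    + g.val p (mlieBracket 𝓘(ℝ, E) Z X p) (Y p)

variable [FiniteDimensional ℝ E]

section
variable {X X' Y Y' Z Z' : (p : M) → TangentSpace 𝓘(ℝ, E) p} {f : M → ℝ} {p : M}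

lemma koszul_smul_left (hf : MDiffAt f p) (hX : MDiffAt (T% X) p) (hY : MDiffAt (T% Y) p)
    (hZ : MDiffAt (T% Z) p) :
    g.koszul (f • X) Y Z p = f p * g.koszul X Y Z p := by
  have h1 : d% (fun q ↦ g.val q (Z q) ((f • X) q)) p
      = f p • d% (fun q ↦ g.val q (Z q) (X q)) p + (g.val p (Z p) (X p)) • d% f p := by
    rw [← mvfderiv_mul hf (g.mdifferentiableAt_apply hZ hX)]
    congr 1; ext q; simp
  have h2 : d% (fun q ↦ g.val q ((f • X) q) (Y q)) p
      = f p • d% (fun q ↦ g.val q (X q) (Y q)) p + (g.val p (X p) (Y p)) • d% f p := by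
    rw [← mvfderiv_mul hf (g.mdifferentiableAt_apply hX hY)]
    congr 1; ext q; simp
  simp only [koszul, h1, h2, mlieBracket_smul_left hf hX, mlieBracket_smul_right hf hX]
  simp [g.symm p (X p)]
  ring

lemma koszul_add_left (hX : MDiffAt (T% X) p) (hX' : MDiffAt (T% X') p) (hY : MDiffAt (T% Y) p)
    (hZ : MDiffAt (T% Z) p) :
    g.koszul (X + X') Y Z p = g.koszul X Y Z p + g.koszul X' Y Z p := by
  have h1 : d% (fun q ↦ g.val q (Z q) ((X + X') q)) p
      = d% (fun q ↦ g.val q (Z q) (X q)) p + d% (fun q ↦ g.val q (Z q) (X' q)) p := by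
    rw [← mvfderiv_add (g.mdifferentiableAt_apply hZ hX) (g.mdifferentiableAt_apply hZ hX')]
    congr 1; ext q; simp
  have h2 : d% (fun q ↦ g.val q ((X + X') q) (Y q)) p
      = d% (fun q ↦ g.val q (X q) (Y q)) p + d% (fun q ↦ g.val q (X' q) (Y q)) p := by
    rw [← mvfderiv_add (g.mdifferentiableAt_apply hX hY) (g.mdifferentiableAt_apply hX' hY)]
    congr 1; ext q; simp
  simp only [koszul, h1, h2, mlieBracket_add_left hX hX', mlieBracket_add_right hX hX']
  simp
  ring

lemma koszul_smul_right (hf : MDiffAt f p) (hX : MDiffAt (T% X) p) (hY : MDiffAt (T% Y) p)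
    (hZ : MDiffAt (T% Z) p) :
    g.koszul X Y (f • Z) p = f p * g.koszul X Y Z p := by
  have h1 : d% (fun q ↦ g.val q (Y q) ((f • Z) q)) p
      = f p • d% (fun q ↦ g.val q (Y q) (Z q)) p + (g.val p (Y p) (Z p)) • d% f p := by
    rw [← mvfderiv_mul hf (g.mdifferentiableAt_apply hY hZ)]
    congr 1; ext q; simp
  have h2 : d% (fun q ↦ g.val q ((f • Z) q) (X q)) p
      = f p • d% (fun q ↦ g.val q (Z q) (X q)) p + (g.val p (Z p) (X p)) • d% f p := by
    rw [← mvfderiv_mul hf (g.mdifferentiableAt_apply hZ hX)]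
    congr 1; ext q; simp
  simp only [koszul, h1, h2, mlieBracket_smul_left hf hZ, mlieBracket_smul_right hf hZ]
  simp [g.symm p (Y p)]
  ring

lemma koszul_add_right (hX : MDiffAt (T% X) p) (hY : MDiffAt (T% Y) p) (hZ : MDiffAt (T% Z) p)
    (hZ' : MDiffAt (T% Z') p) :
    g.koszul X Y (Z + Z') p = g.koszul X Y Z p + g.koszul X Y Z' p := by
  have h1 : d% (fun q ↦ g.val q (Y q) ((Z + Z') q)) p
      = d% (fun q ↦ g.val q (Y q) (Z q)) p + d% (fun q ↦ g.val q (Y q) (Z' q)) p := by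
    rw [← mvfderiv_add (g.mdifferentiableAt_apply hY hZ) (g.mdifferentiableAt_apply hY hZ')]
    congr 1; ext q; simp
  have h2 : d% (fun q ↦ g.val q ((Z + Z') q) (X q)) p
      = d% (fun q ↦ g.val q (Z q) (X q)) p + d% (fun q ↦ g.val q (Z' q) (X q)) p := by
    rw [← mvfderiv_add (g.mdifferentiableAt_apply hZ hX) (g.mdifferentiableAt_apply hZ' hX)]
    congr 1; ext q; simp
  simp only [koszul, h1, h2, mlieBracket_add_left hZ hZ', mlieBracket_add_right hZ hZ']
  simp
  ring

lemma koszul_smul_middle (hf : MDiffAt f p) (hX : MDiffAt (T% X) p) (hY : MDiffAt (T% Y) p)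
    (hZ : MDiffAt (T% Z) p) :
    g.koszul X (f • Y) Z p
      = f p * g.koszul X Y Z p + 2 * ((d% f p) (X p) * g.val p (Y p) (Z p)) := by
  have h1 : d% (fun q ↦ g.val q ((f • Y) q) (Z q)) p
      = f p • d% (fun q ↦ g.val q (Y q) (Z q)) p + (g.val p (Y p) (Z p)) • d% f p := by
    rw [← mvfderiv_mul hf (g.mdifferentiableAt_apply hY hZ)]
    congr 1; ext q; simp
  have h2 : d% (fun q ↦ g.val q (X q) ((f • Y) q)) p
      = f p • d% (fun q ↦ g.val q (X q) (Y q)) p + (g.val p (X p) (Y p)) • d% f p := by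
    rw [← mvfderiv_mul hf (g.mdifferentiableAt_apply hX hY)]
    congr 1; ext q; simp
  simp only [koszul, h1, h2, mlieBracket_smul_left hf hY, mlieBracket_smul_right hf hY]
  simp [g.symm p (Y p)]
  ring

lemma koszul_add_middle (hX : MDiffAt (T% X) p) (hY : MDiffAt (T% Y) p) (hY' : MDiffAt (T% Y') p)
    (hZ : MDiffAt (T% Z) p) :
    g.koszul X (Y + Y') Z p = g.koszul X Y Z p + g.koszul X Y' Z p := by
  have h1 : d% (fun q ↦ g.val q ((Y + Y') q) (Z q)) p
      = d% (fun q ↦ g.val q (Y q) (Z q)) p + d% (fun q ↦ g.val q (Y' q) (Z q)) p := by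
    rw [← mvfderiv_add (g.mdifferentiableAt_apply hY hZ) (g.mdifferentiableAt_apply hY' hZ)]
    congr 1; ext q; simp
  have h2 : d% (fun q ↦ g.val q (X q) ((Y + Y') q)) p
      = d% (fun q ↦ g.val q (X q) (Y q)) p + d% (fun q ↦ g.val q (X q) (Y' q)) p := by
    rw [← mvfderiv_add (g.mdifferentiableAt_apply hX hY) (g.mdifferentiableAt_apply hX hY')]
    congr 1; ext q; simp
  simp only [koszul, h1, h2, mlieBracket_add_left hY hY', mlieBracket_add_right hY hY']
  simp
  ring

end

lemma finrank_tangentSpace_dual (p : M) : Module.finrank ℝ (TangentSpace 𝓘(ℝ, E) p)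
    = Module.finrank ℝ (TangentSpace 𝓘(ℝ, E) p →L[ℝ] ℝ) := by
  change Module.finrank ℝ E = Module.finrank ℝ (E →L[ℝ] ℝ)
  rw [← (LinearMap.toContinuousLinearMap (𝕜 := ℝ) (E := E) (F' := ℝ)).finrank_eq]
  exact (Subspace.dual_finrank_eq (K := ℝ) (V := E)).symm

lemma injective_val (p : M) : Function.Injective (g.val p).toLinearMap := by
  rw [← LinearMap.ker_eq_bot, LinearMap.ker_eq_bot']
  intro u hu
  exact g.nondegenerate p u fun v ↦ by simpa using congr($hu v)

instance (p : M) : FiniteDimensional ℝ (TangentSpace 𝓘(ℝ, E) p) :=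
  inferInstanceAs (FiniteDimensional ℝ E)

instance (p : M) : FiniteDimensional ℝ (TangentSpace 𝓘(ℝ, E) p →L[ℝ] ℝ) :=
  inferInstanceAs (FiniteDimensional ℝ (E →L[ℝ] ℝ))

/-- The musical isomorphism `T_p M ≃ (T_p M)^*`, `u ↦ g_p(u, ·)`, of a metric tensor. -/
def flat (p : M) : TangentSpace 𝓘(ℝ, E) p ≃ₗ[ℝ] (TangentSpace 𝓘(ℝ, E) p →L[ℝ] ℝ) :=
  LinearEquiv.ofInjectiveOfFinrankEq (g.val p).toLinearMap (g.injective_val p)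
    (finrank_tangentSpace_dual p)

@[simp] lemma flat_apply (p : M) (u : TangentSpace 𝓘(ℝ, E) p) : g.flat p u = g.val p u := rfl

/-- The inverse of the musical isomorphism, as a continuous linear map. -/
def sharp (p : M) : (TangentSpace 𝓘(ℝ, E) p →L[ℝ] ℝ) →L[ℝ] TangentSpace 𝓘(ℝ, E) p :=
  LinearMap.toContinuousLinearMap (𝕜 := ℝ) (E := E →L[ℝ] ℝ) (F' := E) (g.flat p).symm.toLinearMap

@[simp] lemma val_sharp (p : M) (l : TangentSpace 𝓘(ℝ, E) p →L[ℝ] ℝ) :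
    g.val p (g.sharp p l) = l :=
  (g.flat p).apply_symm_apply l

open Classical in
/-- The derivative `(∇ Y)_p : T_p M → T_p M` for the Levi-Civita connection: the endomorphism
determined by the Koszul formula when `Y` is differentiable at `p` (see `two_mul_val_nabla`), and
zero otherwise. -/
def nabla (Y : (p : M) → TangentSpace 𝓘(ℝ, E) p) (p : M) :
    TangentSpace 𝓘(ℝ, E) p →L[ℝ] TangentSpace 𝓘(ℝ, E) p :=
  if hY : MDiffAt (T% Y) p then
    (g.sharp p) ∘L ((1 / 2 : ℝ) • TensorialAt.mkHom₂ (I := 𝓘(ℝ, E)) (F := E) (F' := E)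
      (fun X Z ↦ g.koszul X Y Z p) p
      (fun _ hZ ↦ ⟨fun hf hX ↦ g.koszul_smul_left hf hX hY hZ,
        fun hX hX' ↦ g.koszul_add_left hX hX' hY hZ⟩)
      (fun _ hX ↦ ⟨fun hf hZ ↦ g.koszul_smul_right hf hX hY hZ,
        fun hZ hZ' ↦ g.koszul_add_right hX hY hZ hZ'⟩))
  else 0

/-- The Koszul formula `2 g(∇_X Y, Z) = koszul X Y Z`. -/
lemma two_mul_val_nabla {X Y Z : (p : M) → TangentSpace 𝓘(ℝ, E) p} {p : M}
    (hX : MDiffAt (T% X) p) (hY : MDiffAt (T% Y) p) (hZ : MDiffAt (T% Z) p) :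
    2 * g.val p (g.nabla Y p (X p)) (Z p) = g.koszul X Y Z p := by
  simp only [nabla, hY, dif_pos, ContinuousLinearMap.comp_apply, val_sharp,
    smul_apply, smul_eq_mul]
  rw [TensorialAt.mkHom₂_apply _ _ hX hZ]
  ring

lemma ext_of_val {p : M} {u v : TangentSpace 𝓘(ℝ, E) p}
    (h : ∀ w, g.val p u w = g.val p v w) : u = v :=
  g.injective_val p (ContinuousLinearMap.ext h)

/-- The Levi-Civita connection of a metric tensor. -/
def leviCivita :
    CovariantDerivative 𝓘(ℝ, E) E (TangentSpace 𝓘(ℝ, E) : M → Type _) where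
  toFun := g.nabla
  isCovariantDerivativeOnUniv :=
    { add := by
        intro Y Y' p hY hY' _
        ext u
        refine g.ext_of_val fun w ↦ ?_
        have hu := FiberBundle.mdifferentiableAt_extend 𝓘(ℝ, E) E u
        have hw := FiberBundle.mdifferentiableAt_extend 𝓘(ℝ, E) E w
        have h := g.koszul_add_middle hu hY hY' hw
        rw [← g.two_mul_val_nabla hu hY hw, ← g.two_mul_val_nabla hu hY' hw,
          ← g.two_mul_val_nabla hu (mdifferentiableAt_add_section hY hY') hw] at h
        simp only [FiberBundle.extend_apply_self] at h
        simp
        linarith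
      leibniz := by
        intro Y f p hY hf _
        ext u
        refine g.ext_of_val fun w ↦ ?_
        have hu := FiberBundle.mdifferentiableAt_extend 𝓘(ℝ, E) E u
        have hw := FiberBundle.mdifferentiableAt_extend 𝓘(ℝ, E) E w
        have h := g.koszul_smul_middle hf hu hY hw
        rw [← g.two_mul_val_nabla hu hY hw,
          ← g.two_mul_val_nabla hu (hf.smul_section hY) hw] at h
        simp only [FiberBundle.extend_apply_self] at h
        simp
        linarith }

/-- The Levi-Civita connection is torsion-free. -/
lemma leviCivita_torsion {X Y : (p : M) → TangentSpace 𝓘(ℝ, E) p} {p : M}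
    (hX : MDiffAt (T% X) p) (hY : MDiffAt (T% Y) p) :
    g.leviCivita Y p (X p) - g.leviCivita X p (Y p) = mlieBracket 𝓘(ℝ, E) X Y p := by
  refine g.ext_of_val fun w ↦ ?_
  have hw := FiberBundle.mdifferentiableAt_extend 𝓘(ℝ, E) E w
  have h1 := g.two_mul_val_nabla hX hY hw
  have h2 := g.two_mul_val_nabla hY hX hw
  simp only [koszul, FiberBundle.extend_apply_self] at h1 h2
  rw [mlieBracket_swap_apply (V := Y) (W := X),
    mlieBracket_swap_apply (V := X) (W := FiberBundle.extend E w)] at h2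
  rw [mlieBracket_swap_apply (V := FiberBundle.extend E w) (W := Y)] at h2
  have e (A B : (p : M) → TangentSpace 𝓘(ℝ, E) p) :
    (fun q ↦ g.val q (A q) (B q)) = fun q ↦ g.val q (B q) (A q) := by ext q; exact g.symm ..
  rw [e X (FiberBundle.extend E w), e (FiberBundle.extend E w) Y, e Y X] at h2
  change g.val p (g.nabla Y p (X p) - g.nabla X p (Y p)) w = _
  simp only [map_sub, map_neg, sub_apply, neg_apply]
    at h1 h2 ⊢
  linarith

/-- The Levi-Civita connection is metric. -/
lemma leviCivita_metric {X Y Z : (p : M) → TangentSpace 𝓘(ℝ, E) p} {p : M}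
    (hX : MDiffAt (T% X) p) (hY : MDiffAt (T% Y) p) (hZ : MDiffAt (T% Z) p) :
    (d% (fun q ↦ g.val q (Y q) (Z q)) p) (X p)
      = g.val p (g.leviCivita Y p (X p)) (Z p) + g.val p (Y p) (g.leviCivita Z p (X p)) := by
  have h1 := g.two_mul_val_nabla hX hY hZ
  have h2 := g.two_mul_val_nabla hX hZ hY
  rw [g.symm p (Y p)]
  change _ = g.val p (g.nabla Y p (X p)) (Z p) + g.val p (g.nabla Z p (X p)) (Y p)
  simp only [koszul] at h1 h2
  rw [mlieBracket_swap_apply (V := X) (W := Z), mlieBracket_swap_apply (V := Z) (W := Y),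
    mlieBracket_swap_apply (V := Y) (W := X)] at h2
  have e (A B : (p : M) → TangentSpace 𝓘(ℝ, E) p) :
    (fun q ↦ g.val q (A q) (B q)) = fun q ↦ g.val q (B q) (A q) := by ext q; exact g.symm ..
  rw [e X Z, e Z Y, e Y X] at h2
  simp only [map_neg, neg_apply] at h1 h2
  linarith

/-- The curvature `R(X, Y) Z = ∇_X ∇_Y Z - ∇_Y ∇_X Z - ∇_[X, Y] Z` of the Levi-Civita
connection. In Lean `∇_X Y` at `q` is `g.leviCivita Y q (X q)`. -/
def curvature (X Y Z : (p : M) → TangentSpace 𝓘(ℝ, E) p) (p : M) : TangentSpace 𝓘(ℝ, E) p :=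
  g.leviCivita (fun q ↦ g.leviCivita Z q (Y q)) p (X p)
    - g.leviCivita (fun q ↦ g.leviCivita Z q (X q)) p (Y p)
    - g.leviCivita Z p (mlieBracket 𝓘(ℝ, E) X Y p)

/-- The Gram determinant of two tangent vectors: they span a nondegenerate plane if and only if it
is nonzero. -/
def gram (p : M) (u v : TangentSpace 𝓘(ℝ, E) p) : ℝ :=
  g.val p u u * g.val p v v - g.val p u v ^ 2

/-- The sectional curvature at `p` of the plane spanned by `X p` and `Y p` (meaningful if this
plane is nondegenerate). -/
def sectionalCurvature (X Y : (p : M) → TangentSpace 𝓘(ℝ, E) p) (p : M) : ℝ :=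
  g.val p (g.curvature X Y Y p) (X p) / g.gram p (X p) (Y p)

/-- At every point `p`, all nondegenerate tangent planes have sectional curvature `k p`. A plane is
given by two vector fields, smooth near `p`, whose values at `p` span it. -/
def HasPointwiseConstantSectionalCurvature (k : M → ℝ) : Prop :=
  ∀ (p : M) (X Y : (p : M) → TangentSpace 𝓘(ℝ, E) p),
    CMDiffAt ∞ (T% X) p → CMDiffAt ∞ (T% Y) p → g.gram p (X p) (Y p) ≠ 0 →
      g.sectionalCurvature X Y p = k p

end MetricTensor

/-- Smooth tensor fields `(φ, ξ, η)` on `M` of types `(1,1)`, `(1,0)` and `(0,1)`. -/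
structure TensorTriple (E : Type*) [NormedAddCommGroup E] [NormedSpace ℝ E]
    (M : Type*) [TopologicalSpace M] [ChartedSpace E M] [IsManifold 𝓘(ℝ, E) ∞ M] where
  phi (p : M) : TangentSpace 𝓘(ℝ, E) p →L[ℝ] TangentSpace 𝓘(ℝ, E) p
  xi (p : M) : TangentSpace 𝓘(ℝ, E) p
  eta (p : M) : TangentSpace 𝓘(ℝ, E) p →L[ℝ] ℝ
  contMDiff_phi : ContMDiff 𝓘(ℝ, E) (𝓘(ℝ, E).prod 𝓘(ℝ, E →L[ℝ] E)) ∞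
    (fun p : M ↦ TotalSpace.mk' (E →L[ℝ] E)
      (E := fun p : M ↦ TangentSpace 𝓘(ℝ, E) p →L[ℝ] TangentSpace 𝓘(ℝ, E) p) p (phi p))
  contMDiff_xi : CMDiff ∞ (T% xi)
  contMDiff_eta : ContMDiff 𝓘(ℝ, E) (𝓘(ℝ, E).prod 𝓘(ℝ, E →L[ℝ] ℝ)) ∞
    (fun p : M ↦ TotalSpace.mk' (E →L[ℝ] ℝ)
      (E := fun p : M ↦ TangentSpace 𝓘(ℝ, E) p →L[ℝ] ℝ) p (eta p))

namespace TensorTriple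

variable {E : Type*} [NormedAddCommGroup E] [NormedSpace ℝ E]
  {M : Type*} [TopologicalSpace M] [ChartedSpace E M] [IsManifold 𝓘(ℝ, E) ∞ M]
  (s : TensorTriple E M) (g : MetricTensor E M)

/-- `φ² = I - η ⊗ ξ` and `η(ξ) = 1`. -/
def IsAlmostParacontact : Prop :=
  ∀ p : M, (∀ u, s.phi p (s.phi p u) = u - s.eta p u • s.xi p) ∧ s.eta p (s.xi p) = 1

/-- `φ² = -I + η ⊗ ξ` and `η(ξ) = 1`. -/
def IsAlmostContact : Prop :=
  ∀ p : M, (∀ u, s.phi p (s.phi p u) = -u + s.eta p u • s.xi p) ∧ s.eta p (s.xi p) = 1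

/-- `g(φX, φY) = τ (g(X, Y) - ε η(X) η(Y))` with `ε = g(ξ, ξ) = ±1`. -/
def IsCompatible (τ : ℝ) : Prop :=
  ∀ p : M, (g.val p (s.xi p) (s.xi p) = 1 ∨ g.val p (s.xi p) (s.xi p) = -1) ∧
    ∀ u v, g.val p (s.phi p u) (s.phi p v)
      = τ * (g.val p u v - g.val p (s.xi p) (s.xi p) * (s.eta p u * s.eta p v))

/-- The exterior derivative of `η`, with the normalization
`dη(X, Y) = (X(η(Y)) - Y(η(X)) - η([X, Y])) / 2`. -/
def dEta (X Y : (p : M) → TangentSpace 𝓘(ℝ, E) p) (p : M) : ℝ :=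
  (1 / 2) * ((d% (fun q ↦ s.eta q (Y q)) p) (X p) - (d% (fun q ↦ s.eta q (X q)) p) (Y p)
    - s.eta p (mlieBracket 𝓘(ℝ, E) X Y p))

/-- The Nijenhuis tensor
`N_φ(X, Y) = φ²[X, Y] + [φX, φY] - φ[φX, Y] - φ[X, φY]`. -/
def nijenhuis (X Y : (p : M) → TangentSpace 𝓘(ℝ, E) p) (p : M) : TangentSpace 𝓘(ℝ, E) p :=
  s.phi p (s.phi p (mlieBracket 𝓘(ℝ, E) X Y p))
    + mlieBracket 𝓘(ℝ, E) (fun q ↦ s.phi q (X q)) (fun q ↦ s.phi q (Y q)) p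
    - s.phi p (mlieBracket 𝓘(ℝ, E) (fun q ↦ s.phi q (X q)) Y p)
    - s.phi p (mlieBracket 𝓘(ℝ, E) X (fun q ↦ s.phi q (Y q)) p)

/-- `dη = Φ`, where `Φ(X, Y) = g(X, φY)` is the fundamental 2-form. -/
def IsContactMetric : Prop :=
  ∀ (p : M) (X Y : (p : M) → TangentSpace 𝓘(ℝ, E) p),
    CMDiffAt ∞ (T% X) p → CMDiffAt ∞ (T% Y) p →
      s.dEta X Y p = g.val p (X p) (s.phi p (Y p))

/-- `(φ, ξ, η, g)` is a paraSasakian structure: an almost paracontact metric structure with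
`dη = Φ` that is normal, `N_φ = 2 dη ⊗ ξ`. -/
structure IsParaSasakian : Prop where
  almostParacontact : s.IsAlmostParacontact
  compatible : s.IsCompatible g (-1)
  contact : s.IsContactMetric g
  normal : ∀ (p : M) (X Y : (p : M) → TangentSpace 𝓘(ℝ, E) p),
    CMDiffAt ∞ (T% X) p → CMDiffAt ∞ (T% Y) p →
      s.nijenhuis X Y p = (2 * s.dEta X Y p) • s.xi p

/-- `(φ, ξ, η, g)` is an indefinite Sasakian structure: an almost contact metric structure, for a
metric of arbitrary signature, with `dη = Φ` that is normal, `N_φ + 2 dη ⊗ ξ = 0`. -/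
structure IsIndefiniteSasakian : Prop where
  almostContact : s.IsAlmostContact
  compatible : s.IsCompatible g 1
  contact : s.IsContactMetric g
  normal : ∀ (p : M) (X Y : (p : M) → TangentSpace 𝓘(ℝ, E) p),
    CMDiffAt ∞ (T% X) p → CMDiffAt ∞ (T% Y) p →
      s.nijenhuis X Y p + (2 * s.dEta X Y p) • s.xi p = 0

end TensorTriple

/-- The signs `τ₁ = τ₂ = -1`, `τ₃ = 1`. The indices `1, 2, 3` are `0, 1, 2 : Fin 3` in Lean. -/
def mixedSign : Fin 3 → ℝ := ![-1, -1, 1]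

/-- A mixed 3-structure `(φ_a, ξ_a, η^a)`, `a = 1, 2, 3`. The cyclic permutations of the indices
are `(a, a + 1, a + 2)`, with addition in `Fin 3`. -/
structure MixedThreeStructure (E : Type*) [NormedAddCommGroup E] [NormedSpace ℝ E]
    (M : Type*) [TopologicalSpace M] [ChartedSpace E M] [IsManifold 𝓘(ℝ, E) ∞ M] where
  str : Fin 3 → TensorTriple E M
  paracontact_one : (str 0).IsAlmostParacontact
  paracontact_two : (str 1).IsAlmostParacontact
  contact_three : (str 2).IsAlmostContact
  /-- `φ_a φ_b - τ_a η^b ⊗ ξ_a = τ_c φ_c`. -/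
  phi_comp_phi (a b c : Fin 3) (hb : b = a + 1) (hc : c = a + 2) (p : M)
    (u : TangentSpace 𝓘(ℝ, E) p) :
    (str a).phi p ((str b).phi p u) - mixedSign a • (str b).eta p u • (str a).xi p
      = mixedSign c • (str c).phi p u
  /-- `τ_c φ_c = -φ_b φ_a + τ_b η^a ⊗ ξ_b`. -/
  phi_comp_phi' (a b c : Fin 3) (hb : b = a + 1) (hc : c = a + 2) (p : M)
    (u : TangentSpace 𝓘(ℝ, E) p) :
    mixedSign c • (str c).phi p u
      = -(str b).phi p ((str a).phi p u) + mixedSign b • (str a).eta p u • (str b).xi p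
  /-- `η^a ∘ φ_b = τ_c η^c`. -/
  eta_comp_phi (a b c : Fin 3) (hb : b = a + 1) (hc : c = a + 2) (p : M)
    (u : TangentSpace 𝓘(ℝ, E) p) :
    (str a).eta p ((str b).phi p u) = mixedSign c * (str c).eta p u
  /-- `τ_c η^c = -η^b ∘ φ_a`. -/
  eta_comp_phi' (a b c : Fin 3) (hb : b = a + 1) (hc : c = a + 2) (p : M)
    (u : TangentSpace 𝓘(ℝ, E) p) :
    mixedSign c * (str c).eta p u = -(str b).eta p ((str a).phi p u)
  /-- `φ_a(ξ_b) = τ_b ξ_c`. -/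
  phi_xi (a b c : Fin 3) (hb : b = a + 1) (hc : c = a + 2) (p : M) :
    (str a).phi p ((str b).xi p) = mixedSign b • (str c).xi p
  /-- `φ_b(ξ_a) = -τ_a ξ_c`. -/
  phi_xi' (a b c : Fin 3) (hb : b = a + 1) (hc : c = a + 2) (p : M) :
    (str b).phi p ((str a).xi p) = -(mixedSign a • (str c).xi p)

namespace MixedThreeStructure

variable {E : Type*} [NormedAddCommGroup E] [NormedSpace ℝ E]
  {M : Type*} [TopologicalSpace M] [ChartedSpace E M] [IsManifold 𝓘(ℝ, E) ∞ M]
  (s : MixedThreeStructure E M) (g : MetricTensor E M)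

/-- `(φ_a, ξ_a, η^a, g)` is a mixed metric 3-structure. -/
def IsMetric : Prop := ∀ a, (s.str a).IsCompatible g (mixedSign a)

/-- `(φ_a, ξ_a, η^a, g)` is a mixed 3-Sasakian structure. -/
structure IsThreeSasakian : Prop where
  metric : s.IsMetric g
  paraSasakian_one : (s.str 0).IsParaSasakian g
  paraSasakian_two : (s.str 1).IsParaSasakian g
  sasakian_three : (s.str 2).IsIndefiniteSasakian g

/-- The 3-structure is positive: `ξ₁` and `ξ₂` are spacelike. -/
def IsPositive : Prop :=
  ∀ p, g.val p ((s.str 0).xi p) ((s.str 0).xi p) = 1 ∧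
    g.val p ((s.str 1).xi p) ((s.str 1).xi p) = 1

/-- The 3-structure is negative: `ξ₁` and `ξ₂` are timelike. -/
def IsNegative : Prop :=
  ∀ p, g.val p ((s.str 0).xi p) ((s.str 0).xi p) = -1 ∧
    g.val p ((s.str 1).xi p) ((s.str 1).xi p) = -1

end MixedThreeStructure

end

/-! One plane decides the curvature: the plane of ξ₁ and ξ₂ has Gram determinant 1 and sectional
curvature -σ at every point. A pointwise constant k must take this value there, so k = -σ, and the
equivalence follows at once. The work is to compute the Levi-Civita connection on the Reeb fields
ξ₁, ξ₂, ξ₃ (`s.str 0`, `s.str 1`, `s.str 2`).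

Their brackets come from the contact conditions dη = Φ. Evaluating one at ξ gives L_ξ η = 0, and
since Φ is the differential of η also L_ξ Φ = 0 (`mvfderiv_fundamental_xi`). Feeding a second Reeb
field into L_ξ Φ = 0, and using the contact condition of the third structure, gives φ_r [ξ_r, ξ_s];
inverting φ_r on horizontal vectors gives the bracket itself (`mlieBracket_xi_xi`). As the products
g(ξ_r, ξ_s) are constant, the Koszul formula then reduces ∇_{ξ_r} ξ_s to this bracket and to φ_s
ξ_r, φ_r ξ_s (`two_smul_leviCivita_xi_xi`).

The result is [ξ₁, ξ₂] = -2σ ξ₃, ∇_{ξ₁} ξ₂ = -σ ξ₃, ∇_{ξ₂} ξ₃ = σ ξ₁, ∇_{ξ₃} ξ₂ = -σ ξ₁ and ∇_{ξ₂}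
ξ₂ = 0. Hence R(ξ₁, ξ₂) ξ₂ = σ² ξ₁ - 2σ² ξ₁ = -ξ₁, and g(-ξ₁, ξ₁) = -σ. -/

/-! ### Derivatives of germs and brackets of smooth fields -/

section

variable {E : Type*} [NormedAddCommGroup E] [NormedSpace ℝ E]
  {M : Type*} [TopologicalSpace M] [ChartedSpace E M] [IsManifold 𝓘(ℝ, E) ∞ M]

omit [IsManifold 𝓘(ℝ, E) ∞ M] in
open Topology in
lemma mvfderiv_congr_of_eventuallyEq {f f' : M → ℝ} {p : M} (h : f =ᶠ[𝓝 p] f') :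
    (d% f p : TangentSpace 𝓘(ℝ, E) p →L[ℝ] ℝ) = d% f' p := by
  ext v
  simp only [mvfderiv, h.mfderiv_eq]
  rfl

lemma CMDiffAt_mlieBracket [CompleteSpace E] {X Y : (p : M) → TangentSpace 𝓘(ℝ, E) p} {p : M}
    (hX : CMDiffAt ∞ (T% X) p) (hY : CMDiffAt ∞ (T% Y) p) :
    CMDiffAt ∞ (T% (mlieBracket 𝓘(ℝ, E) X Y)) p := by
  -- The bracket costs one derivative, which is harmless because ∞ + 1 = ∞.
  have : IsManifold 𝓘(ℝ, E) (((⊤ : ℕ∞) : WithTop ℕ∞) + 1) M :=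
    inferInstanceAs (IsManifold 𝓘(ℝ, E) ∞ M)
  have : IsManifold 𝓘(ℝ, E) (minSmoothness ℝ 2) M :=
    IsManifold.of_le (n := ∞) (by simpa using ENat.LEInfty.out)
  exact ContMDiffAt.mlieBracket_vectorField (m := ⊤) (n := ⊤) hX hY (by simp)

lemma jacobi_mlieBracket [CompleteSpace E] {X Y Z : (p : M) → TangentSpace 𝓘(ℝ, E) p} {p : M}
    (hX : CMDiffAt ∞ (T% X) p) (hY : CMDiffAt ∞ (T% Y) p) (hZ : CMDiffAt ∞ (T% Z) p) :
    mlieBracket 𝓘(ℝ, E) X (mlieBracket 𝓘(ℝ, E) Y Z) p =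
      mlieBracket 𝓘(ℝ, E) (mlieBracket 𝓘(ℝ, E) X Y) Z p
        + mlieBracket 𝓘(ℝ, E) Y (mlieBracket 𝓘(ℝ, E) X Z) p := by
  have : IsManifold 𝓘(ℝ, E) (minSmoothness ℝ 3) M :=
    IsManifold.of_le (n := ∞) (by simpa using ENat.LEInfty.out)
  have h2 : minSmoothness ℝ 2 ≤ (∞ : WithTop ℕ∞) := by simpa using ENat.LEInfty.out
  exact leibniz_identity_mlieBracket_apply (hX.of_le h2) (hY.of_le h2) (hZ.of_le h2)

end

/-! ### A single contact or paracontact metric structure -/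

namespace TensorTriple

variable {E : Type*} [NormedAddCommGroup E] [NormedSpace ℝ E]
  {M : Type*} [TopologicalSpace M] [ChartedSpace E M] [IsManifold 𝓘(ℝ, E) ∞ M]

/-- `(φ, ξ, η, g)` is a contact metric structure (`τ = 1`) or a paracontact metric structure
(`τ = -1`), with `g(ξ, ξ) = ε`. No normality is assumed. -/
structure IsContactMetricWith (s : TensorTriple E M) (g : MetricTensor E M) (τ ε : ℝ) : Prop where
  tau_sq : τ * τ = 1
  eps_sq : ε * ε = 1
  eta_xi (p : M) : s.eta p (s.xi p) = 1
  phi_sq (p : M) (u : TangentSpace 𝓘(ℝ, E) p) :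
    s.phi p (s.phi p u) = -(τ • (u - s.eta p u • s.xi p))
  val_xi_xi (p : M) : g.val p (s.xi p) (s.xi p) = ε
  compatible (p : M) (u v : TangentSpace 𝓘(ℝ, E) p) :
    g.val p (s.phi p u) (s.phi p v) = τ * (g.val p u v - ε * (s.eta p u * s.eta p v))
  contact : s.IsContactMetric g

namespace IsContactMetricWith

variable {s : TensorTriple E M} {g : MetricTensor E M} {τ ε : ℝ}
  (h : s.IsContactMetricWith g τ ε)

include h

lemma phi_xi (p : M) : s.phi p (s.xi p) = 0 := by
  have h1 : s.phi p (s.phi p (s.xi p)) = 0 := by simp [h.phi_sq, h.eta_xi]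
  have h2 := h.phi_sq p (s.phi p (s.xi p))
  rw [h1, map_zero] at h2
  have hτ : τ ≠ 0 := fun h0 ↦ by simpa [h0] using h.tau_sq
  -- Since φ² kills φξ, the formula for φ² makes φξ a multiple of ξ. Applying φ and then η shows
  -- that the square of the factor vanishes.
  have h3 : s.phi p (s.xi p) = s.eta p (s.phi p (s.xi p)) • s.xi p := by
    have := (smul_eq_zero.mp (neg_eq_zero.mp h2.symm)).resolve_left hτ
    exact sub_eq_zero.mp this
  have h4 : (s.eta p (s.phi p (s.xi p)) * s.eta p (s.phi p (s.xi p))) = 0 := by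
    have h5 := congr(s.eta p (s.phi p $h3))
    rw [h1, map_smul, map_smul] at h5
    simpa using h5
  rw [h3, mul_self_eq_zero.mp h4, zero_smul]

lemma val_xi_right (p : M) (u : TangentSpace 𝓘(ℝ, E) p) :
    g.val p u (s.xi p) = ε * s.eta p u := by
  have h1 := h.compatible p u (s.xi p)
  rw [h.phi_xi, map_zero, h.eta_xi, mul_one] at h1
  have hτ : τ ≠ 0 := fun h0 ↦ by simpa [h0] using h.tau_sq
  have := (mul_eq_zero.mp h1.symm).resolve_left hτ
  linarith

lemma val_xi_left (p : M) (u : TangentSpace 𝓘(ℝ, E) p) :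
    g.val p (s.xi p) u = ε * s.eta p u := by
  rw [g.symm, h.val_xi_right]

lemma eta_phi (p : M) (u : TangentSpace 𝓘(ℝ, E) p) : s.eta p (s.phi p u) = 0 := by
  have h1 := congr(s.phi p $(h.phi_sq p u))
  rw [h.phi_sq p (s.phi p u)] at h1
  have h2 := congr(s.eta p $h1)
  simp [h.phi_xi, h.eta_xi] at h2
  have hτ : τ ≠ 0 := fun h0 ↦ by simpa [h0] using h.tau_sq
  exact h2.resolve_left hτ

/-- Compatibility at (u, φv), with φ²v expanded, gives skew-symmetry of φ: the terms containing η ∘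
φ drop out, and the two factors τ cancel. -/
lemma val_phi_right (p : M) (u v : TangentSpace 𝓘(ℝ, E) p) :
    g.val p u (s.phi p v) = -g.val p (s.phi p u) v := by
  have h1 := h.compatible p u (s.phi p v)
  rw [h.phi_sq, h.eta_phi] at h1
  simp only [map_neg, map_smul, map_sub, smul_eq_mul, h.val_xi_right, h.eta_phi] at h1
  linear_combination τ * (-h1) - (g.val p u (s.phi p v) + g.val p (s.phi p u) v) * h.tau_sq

/-- `L_ξ η = 0`. -/
lemma mvfderiv_eta_xi {p : M} {Y : (p : M) → TangentSpace 𝓘(ℝ, E) p}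
    (hY : CMDiffAt ∞ (T% Y) p) :
    (d% (fun q ↦ s.eta q (Y q)) p) (s.xi p) = s.eta p (mlieBracket 𝓘(ℝ, E) s.xi Y p) := by
  have h1 := h.contact p s.xi Y (s.contMDiff_xi p) hY
  have h2 : (fun q ↦ s.eta q (s.xi q)) = fun _ ↦ 1 := funext h.eta_xi
  rw [h.val_phi_right, h.phi_xi, dEta, h2, mvfderiv_const] at h1
  simp at h1
  linarith

-- The flow of ξ preserves the horizontal distribution ker η, because L_ξ η = 0.
open Topology in
lemma eta_mlieBracket_xi {p : M} {Y : (p : M) → TangentSpace 𝓘(ℝ, E) p}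
    (hY : CMDiffAt ∞ (T% Y) p) (h0 : ∀ᶠ q in 𝓝 p, s.eta q (Y q) = 0) :
    s.eta p (mlieBracket 𝓘(ℝ, E) s.xi Y p) = 0 := by
  rw [← h.mvfderiv_eta_xi hY, mvfderiv_congr_of_eventuallyEq (f' := fun _ ↦ 0) h0, mvfderiv_const]
  rfl

-- On horizontal fields only the bracket term of dη survives. This expresses Φ through η, so that
-- L_ξ η = 0 can be applied to it.
open Topology in
lemma eta_mlieBracket_of_horizontal {p : M} {X Y : (p : M) → TangentSpace 𝓘(ℝ, E) p}
    (hX : CMDiffAt ∞ (T% X) p) (hY : CMDiffAt ∞ (T% Y) p)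
    (hX0 : ∀ᶠ q in 𝓝 p, s.eta q (X q) = 0) (hY0 : ∀ᶠ q in 𝓝 p, s.eta q (Y q) = 0) :
    g.val p (X p) (s.phi p (Y p)) = -(1 / 2) * s.eta p (mlieBracket 𝓘(ℝ, E) X Y p) := by
  have h1 := h.contact p X Y hX hY
  rw [dEta, mvfderiv_congr_of_eventuallyEq (f' := fun _ ↦ 0) hX0,
    mvfderiv_congr_of_eventuallyEq (f' := fun _ ↦ 0) hY0, mvfderiv_const] at h1
  rw [← h1]
  simp

open Topology in
/-- `L_ξ Φ = 0`, evaluated on horizontal vector fields, where `Φ(X, Y) = g(X, φY)`. -/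
lemma mvfderiv_fundamental_xi [CompleteSpace E] {p : M}
    {X Y : (p : M) → TangentSpace 𝓘(ℝ, E) p}
    (hX : ∀ᶠ q in 𝓝 p, CMDiffAt ∞ (T% X) q) (hY : ∀ᶠ q in 𝓝 p, CMDiffAt ∞ (T% Y) q)
    (hX0 : ∀ᶠ q in 𝓝 p, s.eta q (X q) = 0) (hY0 : ∀ᶠ q in 𝓝 p, s.eta q (Y q) = 0) :
    (d% (fun q ↦ g.val q (X q) (s.phi q (Y q))) p) (s.xi p)
      = g.val p (mlieBracket 𝓘(ℝ, E) s.xi X p) (s.phi p (Y p))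
        + g.val p (X p) (s.phi p (mlieBracket 𝓘(ℝ, E) s.xi Y p)) := by
  have hξ (q : M) : CMDiffAt ∞ (T% s.xi) q := s.contMDiff_xi q
  have hXp := hX.self_of_nhds
  have hYp := hY.self_of_nhds
  -- Brackets with ξ stay horizontal near p, so the formula for Φ on horizontal fields applies to
  -- them as well.
  have h0 {Z : (p : M) → TangentSpace 𝓘(ℝ, E) p} (hZ : ∀ᶠ q in 𝓝 p, CMDiffAt ∞ (T% Z) q)
      (hZ0 : ∀ᶠ q in 𝓝 p, s.eta q (Z q) = 0) :
      ∀ᶠ q in 𝓝 p, s.eta q (mlieBracket 𝓘(ℝ, E) s.xi Z q) = 0 := by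
    filter_upwards [hZ, hZ0.eventually_nhds] with q h1 h2 using h.eta_mlieBracket_xi h1 h2
  -- This identity is about to be differentiated, so it must hold on a neighbourhood; smoothness of
  -- order ∞ at p alone would not provide one.
  have h1 : (fun q ↦ g.val q (X q) (s.phi q (Y q))) =ᶠ[𝓝 p]
      fun q ↦ s.eta q (((-(1 / 2) : ℝ) • mlieBracket 𝓘(ℝ, E) X Y) q) := by
    filter_upwards [hX, hY, hX0.eventually_nhds, hY0.eventually_nhds] with q h1 h2 h3 h4
    rw [h.eta_mlieBracket_of_horizontal h1 h2 h3 h4]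
    simp
  have hXY := CMDiffAt_mlieBracket hXp hYp
  -- Differentiating η([X, Y]) along ξ gives η([ξ, [X, Y]]), which the Jacobi identity splits into
  -- the two terms of the claim.
  rw [mvfderiv_congr_of_eventuallyEq h1, h.mvfderiv_eta_xi hXY.const_smul_section,
    mlieBracket_const_smul_right (hXY.mdifferentiableAt (by simp)),
    h.eta_mlieBracket_of_horizontal (CMDiffAt_mlieBracket (hξ p) hXp) hYp (h0 hX hX0) hY0,
    h.eta_mlieBracket_of_horizontal hXp (CMDiffAt_mlieBracket (hξ p) hYp) hX0 (h0 hY hY0),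
    jacobi_mlieBracket (hξ p) hXp hYp]
  simp

end IsContactMetricWith

end TensorTriple

/-! ### Brackets and covariant derivatives of Reeb fields of several structures -/

namespace TensorTriple

variable {E : Type*} [NormedAddCommGroup E] [NormedSpace ℝ E] [FiniteDimensional ℝ E]
  {M : Type*} [TopologicalSpace M] [ChartedSpace E M] [IsManifold 𝓘(ℝ, E) ∞ M]

namespace IsContactMetricWith

variable {r s t : TensorTriple E M} {g : MetricTensor E M} {τr εr τs εs τt εt : ℝ}

omit [FiniteDimensional ℝ E] in
open Topology in
/-- A vector `u` extends to a vector field, smooth near `p`, whose value at `p` is the horizontal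
part of `u` and which is horizontal everywhere. -/
lemma exists_horizontal_extension (hr : r.IsContactMetricWith g τr εr) (p : M)
    (u : TangentSpace 𝓘(ℝ, E) p) :
    ∃ Z : (p : M) → TangentSpace 𝓘(ℝ, E) p, (∀ᶠ q in 𝓝 p, CMDiffAt ∞ (T% Z) q) ∧
      (∀ q, r.eta q (Z q) = 0) ∧ Z p = u - r.eta p u • r.xi p := by
  obtain ⟨U, hU, hsm⟩ := FiberBundle.exists_contMDiffOn_extend (k := ∞) 𝓘(ℝ, E) E u
  have hsm' : ∀ᶠ q in 𝓝 p, CMDiffAt ∞ (T% (FiberBundle.extend E u)) q := by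
    filter_upwards [eventually_mem_nhds_iff.mpr hU] with q hq using hsm.contMDiffAt hq
  refine ⟨FiberBundle.extend E u
    - (fun q ↦ r.eta q (FiberBundle.extend E u q)) • r.xi, ?_, ?_, ?_⟩
  · filter_upwards [hsm'] with q hq
    have hη : ContMDiffAt 𝓘(ℝ, E) (𝓘(ℝ, E).prod 𝓘(ℝ, ℝ)) ∞
        (fun q ↦ TotalSpace.mk' ℝ (E := Bundle.Trivial M ℝ) q
          (r.eta q (FiberBundle.extend E u q))) q :=
      ContMDiffAt.clm_bundle_apply (F₁ := E) (F₂ := ℝ) (r.contMDiff_eta q) hq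
    simp only [contMDiffAt_totalSpace] at hη
    exact hq.sub_section (ContMDiffAt.smul_section hη.2 (r.contMDiff_xi q))
  · intro q
    simp [hr.eta_xi]
  · simp

/-- If `φ_r ξ_s = ± ξ_t`, the bracket of the Reeb fields `ξ_r` and `ξ_s` is determined by the contact
condition. -/
lemma mlieBracket_xi_xi (hr : r.IsContactMetricWith g τr εr)
    (ht : t.IsContactMetricWith g τt εt) {l m : ℝ} (hl : l * l = 1)
    (h1 : ∀ p, r.phi p (s.xi p) = l • t.xi p) (h2 : ∀ p, t.phi p (r.xi p) = m • s.xi p)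
    (hrs : ∀ p, r.eta p (s.xi p) = 0) (htr : ∀ p, t.eta p (r.xi p) = 0) (p : M) :
    mlieBracket 𝓘(ℝ, E) r.xi s.xi p = (2 * τr * m * εt) • t.xi p := by
  have := FiniteDimensional.complete ℝ E
  set W := mlieBracket 𝓘(ℝ, E) r.xi s.xi p with hW
  have hφ (q : M) (v : TangentSpace 𝓘(ℝ, E) q) :
      g.val q (s.xi q) (r.phi q v) = -(l * εt) * t.eta q v := by
    rw [hr.val_phi_right, h1]
    simp [ht.val_xi_left]
    ring
  -- Both sides lie in ker η_r, so testing against horizontal vectors is enough.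
  have key : r.phi p W = -((2 * l * m * εt) • s.xi p) := by
    refine g.ext_of_val fun u ↦ ?_
    obtain ⟨Z, hZ, hZ0, hZp⟩ := hr.exists_horizontal_extension p u
    -- In L_{ξ_r} Φ_r = 0 at (ξ_s, Z), the function Φ_r(ξ_s, Z) is -l ε_t η_t(Z). What remains is
    -- g(φ_r W, Z) = 2 l ε_t dη_t(ξ_r, Z), and the contact condition for t evaluates the right side.
    have e1 := hr.mvfderiv_fundamental_xi (X := s.xi) (Y := Z)
      (Filter.Eventually.of_forall fun q ↦ s.contMDiff_xi q) hZ
      (Filter.Eventually.of_forall hrs) (Filter.Eventually.of_forall hZ0)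
    have hηZ : MDiffAt (fun q ↦ t.eta q (Z q)) p := by
      have hη : MDifferentiableAt 𝓘(ℝ, E) (𝓘(ℝ, E).prod 𝓘(ℝ, ℝ))
          (fun q ↦ TotalSpace.mk' ℝ (E := Bundle.Trivial M ℝ) q (t.eta q (Z q))) p :=
        MDifferentiableAt.clm_bundle_apply (F₁ := E) (F₂ := ℝ)
          ((t.contMDiff_eta p).mdifferentiableAt (by simp))
          (hZ.self_of_nhds.mdifferentiableAt (by simp))
      simp only [mdifferentiableAt_totalSpace] at hη
      exact hη.2
    have e2 : d% (fun q ↦ g.val q (s.xi q) (r.phi q (Z q))) p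
        = (-(l * εt)) • d% (fun q ↦ t.eta q (Z q)) p := by
      have := mvfderiv_mul (mdifferentiableAt_const (c := -(l * εt))) hηZ
      rw [mvfderiv_const, smul_zero, add_zero] at this
      rw [← this]
      congr 1
      ext q
      simp [hφ]
    have e3 := ht.contact p r.xi Z (r.contMDiff_xi p) hZ.self_of_nhds
    rw [dEta, funext htr, mvfderiv_const, ht.val_phi_right, h2] at e3
    rw [e2, hφ, ← hW, hr.val_phi_right] at e1
    have e4 (v : TangentSpace 𝓘(ℝ, E) p) (hv : r.eta p v = 0) : g.val p v (Z p) = g.val p v u := by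
      rw [hZp]
      simp [hr.val_xi_right, hv]
    rw [e4 _ (hr.eta_phi p W)] at e1
    simp only [map_smul, smul_apply, smul_eq_mul] at e1 e3
    rw [e4 _ (hrs p)] at e3
    simp at e1 e3 ⊢
    linear_combination e1 + 2 * l * εt * e3
  have hη : r.eta p W = 0 :=
    hr.eta_mlieBracket_xi (s.contMDiff_xi p) (Filter.Eventually.of_forall hrs)
  have k2 := congr(r.phi p $key)
  -- As W is horizontal, φ_r² W = -τ_r W; applying φ_r to `key` therefore recovers W.
  rw [hr.phi_sq, hη, map_neg, map_smul, h1, zero_smul, sub_zero, smul_smul, neg_inj] at k2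
  have k3 := congr(τr • $k2)
  rw [smul_smul, hr.tau_sq, one_smul, smul_smul] at k3
  rw [k3]
  congr 1
  linear_combination 2 * τr * m * εt * hl

/-- The Levi-Civita connection on two Reeb fields whose inner product is constant. -/
lemma two_smul_leviCivita_xi_xi (hr : r.IsContactMetricWith g τr εr)
    (hs : s.IsContactMetricWith g τs εs) {c : ℝ} (hrs : ∀ p, r.eta p (s.xi p) = c) (p : M) :
    (2 : ℝ) • g.leviCivita s.xi p (r.xi p) = mlieBracket 𝓘(ℝ, E) r.xi s.xi p
      - (2 * εs) • s.phi p (r.xi p) - (2 * εr) • r.phi p (s.xi p) := by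
  refine g.ext_of_val fun w ↦ ?_
  have hw := FiberBundle.contMDiffAt_extend (k := ∞) 𝓘(ℝ, E) E w
  set Z := FiberBundle.extend E w with hZ
  have hZp : Z p = w := by simp [hZ]
  have hη (t : TensorTriple E M) : MDiffAt (fun q ↦ t.eta q (Z q)) p := by
    have h : MDifferentiableAt 𝓘(ℝ, E) (𝓘(ℝ, E).prod 𝓘(ℝ, ℝ))
        (fun q ↦ TotalSpace.mk' ℝ (E := Bundle.Trivial M ℝ) q (t.eta q (Z q))) p :=
      MDifferentiableAt.clm_bundle_apply (F₁ := E) (F₂ := ℝ)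
        ((t.contMDiff_eta p).mdifferentiableAt (by simp)) (hw.mdifferentiableAt (by simp))
    simp only [mdifferentiableAt_totalSpace] at h
    exact h.2
  -- Both η_s(ξ_r) and η_r(ξ_s) are g(ξ_r, ξ_s) up to a sign, so one is constant when the other is.
  have hsr (q : M) : s.eta q (r.xi q) = εs * (εr * c) := by
    have := hs.val_xi_left q (r.xi q)
    rw [hr.val_xi_right, hrs] at this
    linear_combination -(s.eta q (r.xi q)) * hs.eps_sq - εs * this
  have hmul (a : ℝ) {f : M → ℝ} (hf : MDiffAt f p) :
      d% (fun q ↦ a * f q) p = a • d% f p := by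
    have := mvfderiv_mul (mdifferentiableAt_const (c := a)) hf
    rwa [mvfderiv_const, smul_zero, add_zero] at this
  have e := g.two_mul_val_nabla ((r.contMDiff_xi p).mdifferentiableAt (by simp))
    ((s.contMDiff_xi p).mdifferentiableAt (by simp)) (hw.mdifferentiableAt (by simp))
  simp only [MetricTensor.koszul, hs.val_xi_left, hs.val_xi_right, hr.val_xi_right,
    hsr, hmul _ (hη _), mvfderiv_const] at e
  rw [mlieBracket_swap_apply (V := Z) (W := r.xi), hZp] at e
  have er := hr.contact p s.xi Z (s.contMDiff_xi p) hw
  have es := hs.contact p r.xi Z (r.contMDiff_xi p) hw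
  rw [dEta, hr.val_phi_right, funext hrs, mvfderiv_const, hZp] at er
  rw [dEta, hs.val_phi_right, funext hsr, mvfderiv_const, hZp] at es
  change g.val p ((2 : ℝ) • g.nabla s.xi p (r.xi p)) w = _
  simp at e er es ⊢
  -- Apart from g([ξ_r, ξ_s], Z), the Koszul terms group into 2 ε_s dη_s(ξ_r, Z) + 2 ε_r dη_r(ξ_s,
  -- Z); the contact conditions turn these into the φ terms.
  linear_combination e + 2 * εr * er + 2 * εs * es

lemma leviCivita_xi_xi_self (hr : r.IsContactMetricWith g τr εr) (p : M) :
    g.leviCivita r.xi p (r.xi p) = 0 := by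
  have h := hr.two_smul_leviCivita_xi_xi hr hr.eta_xi p
  simpa [hr.phi_xi] using h

end IsContactMetricWith

end TensorTriple

/-! ### The three Reeb fields of a mixed 3-Sasakian structure -/

namespace MixedThreeStructure

variable {E : Type*} [NormedAddCommGroup E] [NormedSpace ℝ E]
  {M : Type*} [TopologicalSpace M] [ChartedSpace E M] [IsManifold 𝓘(ℝ, E) ∞ M]
  (s : MixedThreeStructure E M) {g : MetricTensor E M}

lemma phi_zero_xi_one (p : M) : (s.str 0).phi p ((s.str 1).xi p) = -(s.str 2).xi p := by
  simpa [mixedSign] using s.phi_xi 0 1 2 rfl rfl p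

lemma phi_one_xi_zero (p : M) : (s.str 1).phi p ((s.str 0).xi p) = (s.str 2).xi p := by
  simpa [mixedSign] using s.phi_xi' 0 1 2 rfl rfl p

lemma phi_one_xi_two (p : M) : (s.str 1).phi p ((s.str 2).xi p) = (s.str 0).xi p := by
  simpa [mixedSign] using s.phi_xi 1 2 0 rfl rfl p

lemma phi_two_xi_one (p : M) : (s.str 2).phi p ((s.str 1).xi p) = (s.str 0).xi p := by
  simpa [mixedSign] using s.phi_xi' 1 2 0 rfl rfl p

lemma phi_two_xi_zero (p : M) : (s.str 2).phi p ((s.str 0).xi p) = -(s.str 1).xi p := by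
  simpa [mixedSign] using s.phi_xi 2 0 1 rfl rfl p

lemma phi_zero_xi_two (p : M) : (s.str 0).phi p ((s.str 2).xi p) = -(s.str 1).xi p := by
  simpa [mixedSign] using s.phi_xi' 2 0 1 rfl rfl p

namespace IsThreeSasakian

variable {s} (hs : s.IsThreeSasakian g) {σ : ℝ}

include hs

lemma isContactMetricWith_zero (hσ : σ * σ = 1)
    (h0 : ∀ p, g.val p ((s.str 0).xi p) ((s.str 0).xi p) = σ) :
    (s.str 0).IsContactMetricWith g (-1) σ where
  tau_sq := by norm_num
  eps_sq := hσ
  eta_xi p := (s.paracontact_one p).2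
  phi_sq p u := by rw [(s.paracontact_one p).1 u]; simp
  val_xi_xi := h0
  compatible p u v := by rw [(hs.paraSasakian_one.compatible p).2 u v, h0]
  contact := hs.paraSasakian_one.contact

lemma isContactMetricWith_one (hσ : σ * σ = 1)
    (h1 : ∀ p, g.val p ((s.str 1).xi p) ((s.str 1).xi p) = σ) :
    (s.str 1).IsContactMetricWith g (-1) σ where
  tau_sq := by norm_num
  eps_sq := hσ
  eta_xi p := (s.paracontact_two p).2
  phi_sq p u := by rw [(s.paracontact_two p).1 u]; simp
  val_xi_xi := h1
  compatible p u v := by rw [(hs.paraSasakian_two.compatible p).2 u v, h1]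
  contact := hs.paraSasakian_two.contact

/-- The paracontact φ₂ reverses the sign of g on ker η², which contains ξ₁, and carries ξ₁ to ξ₃; so
ξ₃ has the opposite causal character. -/
lemma val_xi_two (hσ : σ * σ = 1)
    (h0 : ∀ p, g.val p ((s.str 0).xi p) ((s.str 0).xi p) = σ)
    (h1 : ∀ p, g.val p ((s.str 1).xi p) ((s.str 1).xi p) = σ) (p : M) :
    g.val p ((s.str 2).xi p) ((s.str 2).xi p) = -σ := by
  have c1 := hs.isContactMetricWith_one hσ h1
  rw [← s.phi_one_xi_zero, c1.compatible, h0, ← s.phi_one_xi_two, c1.eta_phi]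
  simp

lemma isContactMetricWith_two (hσ : σ * σ = 1)
    (h0 : ∀ p, g.val p ((s.str 0).xi p) ((s.str 0).xi p) = σ)
    (h1 : ∀ p, g.val p ((s.str 1).xi p) ((s.str 1).xi p) = σ) :
    (s.str 2).IsContactMetricWith g 1 (-σ) where
  tau_sq := by norm_num
  eps_sq := by simpa using hσ
  eta_xi p := (s.contact_three p).2
  phi_sq p u := by rw [(s.contact_three p).1 u]; simp; abel
  val_xi_xi := hs.val_xi_two hσ h0 h1
  compatible p u v := by
    rw [(hs.sasakian_three.compatible p).2 u v, hs.val_xi_two hσ h0 h1]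
  contact := hs.sasakian_three.contact

variable [FiniteDimensional ℝ E]

/-- The plane spanned by `ξ₁` and `ξ₂` is nondegenerate and has sectional curvature `-σ`. -/
lemma sectionalCurvature_xi_xi (hσ : σ * σ = 1)
    (h0 : ∀ p, g.val p ((s.str 0).xi p) ((s.str 0).xi p) = σ)
    (h1 : ∀ p, g.val p ((s.str 1).xi p) ((s.str 1).xi p) = σ) (p : M) :
    g.gram p ((s.str 0).xi p) ((s.str 1).xi p) = 1 ∧
      g.sectionalCurvature (s.str 0).xi (s.str 1).xi p = -σ := by
  have c0 := hs.isContactMetricWith_zero hσ h0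
  have c1 := hs.isContactMetricWith_one hσ h1
  have c2 := hs.isContactMetricWith_two hσ h0 h1
  have hd (a : Fin 3) (q : M) : MDiffAt (T% (s.str a).xi) q :=
    ((s.str a).contMDiff_xi q).mdifferentiableAt (by simp)
  -- Up to sign, each ξ_b is φ_a of the third Reeb field, and η^a ∘ φ_a = 0.
  have e01 (q : M) : (s.str 0).eta q ((s.str 1).xi q) = 0 := by
    have := c0.eta_phi q ((s.str 2).xi q)
    rwa [s.phi_zero_xi_two, map_neg, neg_eq_zero] at this
  have e10 (q : M) : (s.str 1).eta q ((s.str 0).xi q) = 0 := by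
    rw [← s.phi_one_xi_two, c1.eta_phi]
  have e20 (q : M) : (s.str 2).eta q ((s.str 0).xi q) = 0 := by
    rw [← s.phi_two_xi_one, c2.eta_phi]
  have e12 (q : M) : (s.str 1).eta q ((s.str 2).xi q) = 0 := by
    rw [← s.phi_one_xi_zero, c1.eta_phi]
  -- The signs l and m are read off from φ₁ξ₂ = -ξ₃ and φ₃ξ₁ = -ξ₂. The minus sign of the bracket
  -- comes from g(ξ₃, ξ₃) = -σ.
  have b01 (q : M) : mlieBracket 𝓘(ℝ, E) (s.str 0).xi (s.str 1).xi q
      = (-(2 * σ)) • (s.str 2).xi q := by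
    rw [c0.mlieBracket_xi_xi c2 (l := -1) (m := -1) (by norm_num)
      (by simpa using s.phi_zero_xi_one) (by simpa using s.phi_two_xi_zero) e01 e20]
    congr 1
    ring
  have b12 (q : M) : mlieBracket 𝓘(ℝ, E) (s.str 1).xi (s.str 2).xi q
      = (2 * σ) • (s.str 0).xi q := by
    rw [c1.mlieBracket_xi_xi c0 (l := 1) (m := -1) (by norm_num)
      (by simpa using s.phi_one_xi_two) (by simpa using s.phi_zero_xi_one) e12 e01]
    congr 1
    ring
  have two : (2 : ℝ) ≠ 0 := two_ne_zero
  have n01 (q : M) : g.leviCivita (s.str 1).xi q ((s.str 0).xi q) = (-σ) • (s.str 2).xi q := by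
    refine smul_right_injective _ two ?_
    dsimp only
    rw [c0.two_smul_leviCivita_xi_xi c1 e01, b01, s.phi_one_xi_zero, s.phi_zero_xi_one]
    module
  have n12 (q : M) : g.leviCivita (s.str 2).xi q ((s.str 1).xi q) = σ • (s.str 0).xi q := by
    refine smul_right_injective _ two ?_
    dsimp only
    rw [c1.two_smul_leviCivita_xi_xi c2 e12, b12, s.phi_two_xi_one, s.phi_one_xi_two]
    module
  -- Vanishing torsion gives this derivative from `n12` and `b12`, without another Koszul
  -- computation.
  have n21 (q : M) : g.leviCivita (s.str 1).xi q ((s.str 2).xi q) = (-σ) • (s.str 0).xi q := by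
    have h := g.leviCivita_torsion (hd 1 q) (hd 2 q)
    rw [n12, b12, sub_eq_iff_eq_add] at h
    rw [← sub_eq_iff_eq_add'.mpr h]
    module
  -- The first term vanishes because ∇_{ξ₂} ξ₂ = 0 as a field. The second contributes σ² ξ₁ and the
  -- bracket term -2σ² ξ₁.
  have hR : g.curvature (s.str 0).xi (s.str 1).xi (s.str 1).xi p = -(s.str 0).xi p := by
    have z : (fun q ↦ g.leviCivita (s.str 1).xi q ((s.str 1).xi q)) = 0 :=
      funext c1.leviCivita_xi_xi_self
    have z' : (fun q ↦ g.leviCivita (s.str 1).xi q ((s.str 0).xi q)) = (-σ) • (s.str 2).xi :=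
      funext n01
    rw [MetricTensor.curvature, z, z', g.leviCivita.isCovariantDerivativeOnUniv.smul_const _ (hd 2 p),
      b01, CovariantDerivative.zero]
    simp only [map_smul, smul_apply, n12, n21, smul_smul]
    simp [hσ, mul_assoc]
    module
  have hG : g.gram p ((s.str 0).xi p) ((s.str 1).xi p) = 1 := by
    rw [MetricTensor.gram, h0, h1, c0.val_xi_left, e01, hσ]
    simp
  refine ⟨hG, ?_⟩
  rw [MetricTensor.sectionalCurvature, hG, hR]
  simp [h0]

lemma eq_of_hasPointwiseConstantSectionalCurvature (hσ : σ * σ = 1)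
    (h0 : ∀ p, g.val p ((s.str 0).xi p) ((s.str 0).xi p) = σ)
    (h1 : ∀ p, g.val p ((s.str 1).xi p) ((s.str 1).xi p) = σ) {k : M → ℝ}
    (hk : g.HasPointwiseConstantSectionalCurvature k) (p : M) : k p = -σ := by
  obtain ⟨hG, hK⟩ := hs.sectionalCurvature_xi_xi hσ h0 h1 p
  rw [← hK, hk p _ _ ((s.str 0).contMDiff_xi p) ((s.str 1).contMDiff_xi p) (by simp [hG])]

lemma exists_hasPointwiseConstantSectionalCurvature_iff (hσ : σ * σ = 1)
    (h0 : ∀ p, g.val p ((s.str 0).xi p) ((s.str 0).xi p) = σ)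
    (h1 : ∀ p, g.val p ((s.str 1).xi p) ((s.str 1).xi p) = σ) :
    (∃ k : M → ℝ, g.HasPointwiseConstantSectionalCurvature k) ↔
      g.HasPointwiseConstantSectionalCurvature (fun _ ↦ -σ) := by
  refine ⟨fun ⟨k, hk⟩ ↦ ?_, fun h ↦ ⟨_, h⟩⟩
  rwa [← funext (hs.eq_of_hasPointwiseConstantSectionalCurvature hσ h0 h1 hk)]

end IsThreeSasakian

end MixedThreeStructure

theorem mainTheorem4
    {E : Type*} [NormedAddCommGroup E] [NormedSpace ℝ E] [FiniteDimensional ℝ E]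
    (n : ℕ) (hn : Module.finrank ℝ E = 4 * n + 3)
    {M : Type*} [TopologicalSpace M] [ChartedSpace E M] [IsManifold 𝓘(ℝ, E) ∞ M]
    (s : MixedThreeStructure E M) (g : MetricTensor E M) (hs : s.IsThreeSasakian g) :
    (s.IsPositive g →
      (∀ k : M → ℝ, g.HasPointwiseConstantSectionalCurvature k → ∀ p, k p = -1) ∧
      ((∃ k : M → ℝ, g.HasPointwiseConstantSectionalCurvature k) ↔
        g.HasPointwiseConstantSectionalCurvature (fun _ ↦ -1))) ∧
    (s.IsNegative g →
      (∀ k : M → ℝ, g.HasPointwiseConstantSectionalCurvature k → ∀ p, k p = 1) ∧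
      ((∃ k : M → ℝ, g.HasPointwiseConstantSectionalCurvature k) ↔
        g.HasPointwiseConstantSectionalCurvature (fun _ ↦ 1))) := by
  refine ⟨fun h ↦ ?_, fun h ↦ ?_⟩
  · have h0 p := (h p).1
    have h1 p := (h p).2
    exact ⟨fun k hk ↦ hs.eq_of_hasPointwiseConstantSectionalCurvature (by norm_num) h0 h1 hk,
      hs.exists_hasPointwiseConstantSectionalCurvature_iff (by norm_num) h0 h1⟩
  · have h0 p := (h p).1
    have h1 p := (h p).2
    -- Puts the value 1 in the form -σ with σ = -1.
    have e : (1 : ℝ) = -(-1) := by norm_num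
    rw [e]
    exact ⟨fun k hk ↦ hs.eq_of_hasPointwiseConstantSectionalCurvature (by norm_num) h0 h1 hk,
      hs.exists_hasPointwiseConstantSectionalCurvature_iff (by norm_num) h0 h1⟩
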